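/- Let $n \ge 2$ and let $a_1 \le \dots \le a_n$ and $b_1 \le \dots \le b_n$ be positive integers such that $$\prod_{i=1}^n \frac{1-q^{a_i}}{1-q^{b_i}} \in \mathbb{Z}[q],$$ and suppose that $$2\, b_n \left\lfloor \frac{b_{n-1}}{2} \right\rfloor - b_1 < a_1 .$$ For $I \subseteq \{1,\dots,n\}$, let $\langle b_i : i \in I\rangle = \{\sum_{i\in I} c_i b_i : c_i \in \mathbb{Z}_{\ge 0}\}$ be the semigroup generated by the $b_i$ with $i\in I$ (so $\langle\emptyset\rangle=\{0\}$). Then, for every $I \subseteq \{1,\dots,n\}$, the multiset $[a_1,\dots,a_n]$ has, counted with multiplicity, at least $\#I$ elements in $\langle b_i : i \in I\rangle$, that is, $$\#\{\, j \in \{1,\dots,n\} : a_j \in \langle b_i : i \in I\rangle \,\} \ge \#I .$$ In particular, $$\prod_{i=1}^n \frac{1-q^{a_i}}{1-q^{b_i}} \in \mathbb{Z}_{\ge 0}[q],$$ that is, this polynomial has non-negative integer coefficients. -/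

import Mathlib

open Polynomial

/-- The multiset `S_I = [s_i : i ∈ I]` attached to an indexed family `s` and a set of indices `I`. -/
def indexedMultiset {n : ℕ} (s : Fin n → ℕ) (I : Finset (Fin n)) : Multiset ℕ :=
  I.val.map s

/-- The underlying set of a multiset. -/
def toset (S : Multiset ℕ) : Set ℕ :=
  {x | x ∈ S}

open Classical in
/-- The multiset `[s ∈ S : s ∈ T]` (with multiplicities) for a multiset `S` and a set `T`. -/
noncomputable def multisetInterSet (S : Multiset ℕ) (T : Set ℕ) : Multiset ℕ :=
  S.filter (fun s => s ∈ T)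

/-- The semigroup of all linear combinations of elements of `S` with non-negative integer
coefficients (`0`, the empty combination, included). -/
def generatedSemigroup (S : Set ℕ) : Set ℕ :=
  (AddSubmonoid.closure S : Set ℕ)

/-- The product of the `(1 - q ^ a_i) / (1 - q ^ b_i)`, in the field of fractions of `ℤ[q]`. -/
noncomputable def qQuotient {n : ℕ} (a b : Fin n → ℕ) : RatFunc ℤ :=
  ∏ i, (1 - RatFunc.X ^ a i) / (1 - RatFunc.X ^ b i)

/-! Let A = K[X_1, …, X_n] with K infinite and X_i of degree b_i. If A has a homogeneous regular
sequence of degrees a_1, …, a_n, the quotient has Hilbert series ∏ (1 - q^{a_i}) / (1 - q^{b_i}),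
and its coefficients are dimensions. Non-negativity thus reduces to finding such a sequence
(`exists_nonneg_powerSeries`).

The semigroup condition suffices for this (`exists_isRegularIdeal`). The elements are chosen one at
a time, keeping a lower bound on the depth of A/I and an upper bound on dim A/P, for primes P ⊇ I,
in terms of the variables outside P. Together these force the next degree a_j to be the weight of a
monomial in the variables outside Q, for every homogeneous associated prime Q. A generic form of
degree a_j therefore avoids all these primes.

The condition itself is arithmetic (`card_le_semigroupCount`). Comparing multiplicities of roots of
unity, every d divides at least as many a_i as b_i. Take d = gcd(b_i : i ∈ I): at least #I of the
a_j are multiples of d. If #I ≥ 2, the lower bound on a_1 puts them beyond Schur's bound for the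
Frobenius number, hence in the semigroup; if #I = 1 this is immediate. -/

/-! ### Regular elements, associated primes and depth in graded rings -/

section GradedRegular

variable {K A : Type*} [Field K] [CommRing A] [Algebra K A]

/-- Multiplication by `y` is injective on `A ⧸ I`. -/
def RegularMod (I : Ideal A) (y : A) : Prop :=
  ∀ u, y * u ∈ I → u ∈ I

/-- A subspace not contained in any of finitely many ideals has a point outside all of them. -/
theorem exists_mem_forall_notMem [Infinite K] (V : Submodule K A) {s : Set (Ideal A)}
    (hs : s.Finite) (h : ∀ Q ∈ s, ∃ v ∈ V, v ∉ Q) : ∃ f ∈ V, ∀ Q ∈ s, f ∉ Q := by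
  classical
  have key := Subspace.biUnion_ne_univ_of_top_notMem (k := K) (E := V)
    (s := hs.toFinset.image fun Q => (Q.restrictScalars K).comap V.subtype) (by
      simp only [Finset.mem_image, Set.Finite.mem_toFinset, not_exists, not_and]
      intro Q hQ hT
      obtain ⟨v, hv, hvQ⟩ := h Q hQ
      have : (⟨v, hv⟩ : V) ∈ (Q.restrictScalars K).comap V.subtype := hT ▸ Submodule.mem_top
      exact hvQ this)
  obtain ⟨f, hf⟩ := (Set.ne_univ_iff_exists_notMem _).1 key
  refine ⟨f, f.2, fun Q hQ hfQ => hf ?_⟩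
  simp only [Set.mem_iUnion]
  exact ⟨_, Finset.mem_image_of_mem _ (hs.mem_toFinset.2 hQ), hfQ⟩

theorem add_one_le_ringKrullDim_quotient {P Q : Ideal A} (hP : P.IsPrime) (h : P < Q) :
    ringKrullDim (A ⧸ Q) + 1 ≤ ringKrullDim (A ⧸ P) := by
  obtain ⟨r, hrQ, hrP⟩ := SetLike.exists_of_lt h
  refine ringKrullDim_succ_le_of_surjective (Ideal.Quotient.factor h.le)
    (Ideal.Quotient.factor_surjective h.le) (r := Ideal.Quotient.mk P r) ?_ ?_
  · rw [mem_nonZeroDivisors_iff_ne_zero, Ne, Ideal.Quotient.eq_zero_iff_mem]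
    exact hrP
  · rw [Ideal.Quotient.factor_mk, Ideal.Quotient.eq_zero_iff_mem]
    exact hrQ

theorem mem_sup_span_iff {I : Ideal A} {y u : A} :
    u ∈ I ⊔ Ideal.span {y} ↔ ∃ v, u - y * v ∈ I := by
  constructor
  · intro h
    obtain ⟨i, hi, z, hz, rfl⟩ := Submodule.mem_sup.1 h
    obtain ⟨c, rfl⟩ := Ideal.mem_span_singleton'.1 hz
    exact ⟨c, by convert hi using 1; ring⟩
  · rintro ⟨v, hv⟩
    have := Ideal.add_mem _ (Ideal.mem_sup_left hv) (Ideal.mem_sup_right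
      (Ideal.mul_mem_right v _ (Ideal.mem_span_singleton_self y)))
    simpa using this

/-- From yu ≡ zv mod I, regularity of z modulo y makes v a multiple of y, and then y cancels. -/
theorem RegularMod.swap {I : Ideal A} {y z : A} (hyI : RegularMod I y)
    (hzI : RegularMod (I ⊔ Ideal.span {y}) z) : RegularMod (I ⊔ Ideal.span {z}) y := by
  intro u hu
  obtain ⟨v, hv⟩ := mem_sup_span_iff.1 hu
  have h1 : v ∈ I ⊔ Ideal.span {y} := hzI v <| mem_sup_span_iff.2 ⟨u, by
    convert I.neg_mem hv using 1; ring⟩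
  obtain ⟨v', hv'⟩ := mem_sup_span_iff.1 h1
  refine mem_sup_span_iff.2 ⟨v', hyI _ ?_⟩
  convert I.add_mem hv (I.mul_mem_left z hv') using 1; ring

variable (𝒜 : ℕ → Submodule K A)

/-- The primes of the form `(I : u)` with `u` homogeneous. -/
def homogeneousAssociatedPrimes (I : Ideal A) : Set (Ideal A) :=
  {Q | Q.IsPrime ∧ ∃ e, ∃ u ∈ 𝒜 e, ∀ q, q ∈ Q ↔ q * u ∈ I}

theorem homogeneousAssociatedPrimes_finite [IsNoetherianRing A] (I : Ideal A) :
    (homogeneousAssociatedPrimes 𝒜 I).Finite := by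
  refine (associatedPrimes.finite A (A ⧸ I)).subset ?_
  rintro Q ⟨hQ, e, u, -, h⟩
  rw [AssociatedPrimes.mem_iff, isAssociatedPrime_iff]
  refine ⟨hQ, Ideal.Quotient.mk I u, ?_⟩
  ext q
  rw [h, Submodule.mem_colon_singleton, Submodule.mem_bot, Algebra.smul_def,
    Ideal.Quotient.algebraMap_eq, ← map_mul, Ideal.Quotient.eq_zero_iff_mem]

theorem le_of_mem_homogeneousAssociatedPrimes {I Q : Ideal A}
    (hQ : Q ∈ homogeneousAssociatedPrimes 𝒜 I) : I ≤ Q := by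
  obtain ⟨-, e, u, -, h⟩ := hQ
  exact fun q hq => (h q).2 (I.mul_mem_right u hq)

theorem RegularMod.notMem {I : Ideal A} {y : A} (h : RegularMod I y) {Q : Ideal A}
    (hQ : Q ∈ homogeneousAssociatedPrimes 𝒜 I) : y ∉ Q := by
  obtain ⟨hp, e, u, -, hu⟩ := hQ
  intro hy
  refine hp.ne_top ((Ideal.eq_top_iff_one _).2 ((hu 1).2 ?_))
  rw [one_mul]
  exact h u ((hu y).1 hy)

/-- `A ⧸ I` has a regular sequence of `r` homogeneous elements of positive degree. -/
def DepthGE : ℕ → Ideal A → Prop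
  | 0, _ => True
  | r + 1, I => ∃ d, 0 < d ∧ ∃ y ∈ 𝒜 d, RegularMod I y ∧ DepthGE r (I ⊔ Ideal.span {y})

/-- No element outside `J` is killed by all of positive degree. -/
def SocleFree (J : Ideal A) : Prop :=
  ∀ u, (∀ d, 0 < d → ∀ v ∈ 𝒜 d, v * u ∈ J) → u ∈ J

theorem DepthGE.socleFree {r : ℕ} {J : Ideal A} (h : DepthGE 𝒜 (r + 1) J) : SocleFree 𝒜 J := by
  obtain ⟨d, hd, y, hy, hreg, -⟩ := h
  exact fun u hu => hreg u (hu d hd y hy)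

theorem SocleFree.exists_notMem {J Q : Ideal A} (h : SocleFree 𝒜 J)
    (hQ : Q ∈ homogeneousAssociatedPrimes 𝒜 J) : ∃ d, 0 < d ∧ ∃ v ∈ 𝒜 d, v ∉ Q := by
  obtain ⟨hp, e, u, hu, hcol⟩ := hQ
  by_contra! hcon
  refine hp.ne_top ((Ideal.eq_top_iff_one _).2 ((hcol 1).2 ?_))
  rw [one_mul]
  exact h u fun d hd v hv => (hcol v).1 (hcon d hd v hv)

/-- The relation xu ≡ yv mod I carries a socle element u modulo y to a socle element v modulo x, an
elementwise form of the fact that both socles compute Ext¹ of the residue field into A/I. -/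
theorem SocleFree.exchange {I : Ideal A} {x y : A} {d : ℕ} (hd : 0 < d) (hxd : x ∈ 𝒜 d)
    (hx : RegularMod I x) (hy : RegularMod I y) (h : SocleFree 𝒜 (I ⊔ Ideal.span {x})) :
    SocleFree 𝒜 (I ⊔ Ideal.span {y}) := by
  intro u hu
  obtain ⟨v, hv⟩ := mem_sup_span_iff.1 (hu d hd x hxd)
  have hvx : v ∈ I ⊔ Ideal.span {x} := by
    refine h v fun k hk q hq => ?_
    obtain ⟨w, hw⟩ := mem_sup_span_iff.1 (hu k hk q hq)
    refine mem_sup_span_iff.2 ⟨w, hy _ ?_⟩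
    convert I.sub_mem (I.mul_mem_left x hw) (I.mul_mem_left q hv) using 1; ring
  obtain ⟨v', hv'⟩ := mem_sup_span_iff.1 hvx
  refine mem_sup_span_iff.2 ⟨v', hx _ ?_⟩
  convert I.add_mem hv (I.mul_mem_left y hv') using 1; ring

variable [GradedAlgebra 𝒜]

theorem isHomogeneous_sup_span {I : Ideal A} (hI : I.IsHomogeneous 𝒜) {y : A} {d : ℕ}
    (hy : y ∈ 𝒜 d) : (I ⊔ Ideal.span {y}).IsHomogeneous 𝒜 :=
  hI.sup (Ideal.homogeneous_span 𝒜 _ (by rintro x rfl; exact ⟨d, hy⟩))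

theorem regularMod_of_homogeneous {I : Ideal A} (hI : I.IsHomogeneous 𝒜) {y : A} {d : ℕ}
    (hy : y ∈ 𝒜 d) (h : ∀ e, ∀ u ∈ 𝒜 e, y * u ∈ I → u ∈ I) : RegularMod I y := by
  intro u hu
  rw [hI.mem_iff] at hu ⊢
  intro e
  refine h e _ (SetLike.coe_mem _) ?_
  rw [← DirectSum.coe_decompose_mul_add_of_left_mem 𝒜 hy]
  exact hu (d + e)

/-- A homogeneous element of `I + (y)` lies in `I`, or is a homogeneous multiple of `y` mod `I`. -/
theorem mem_sup_span_homogeneous {I : Ideal A} (hI : I.IsHomogeneous 𝒜) {y u : A} {d e : ℕ}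
    (hy : y ∈ 𝒜 d) (hu : u ∈ 𝒜 e) (h : u ∈ I ⊔ Ideal.span {y}) :
    u ∈ I ∨ ∃ e', d + e' = e ∧ ∃ v ∈ 𝒜 e', u - y * v ∈ I := by
  obtain ⟨i, hi, z, hz, rfl⟩ := Submodule.mem_sup.1 h
  obtain ⟨c, rfl⟩ := Ideal.mem_span_singleton'.1 hz
  have hie := (hI.mem_iff).1 hi e
  have hue := DirectSum.decompose_of_mem_same 𝒜 hu
  rw [DirectSum.decompose_add, DirectSum.add_apply, Submodule.coe_add] at hue
  rcases le_or_gt d e with hde | hde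
  · obtain ⟨e', rfl⟩ := Nat.exists_eq_add_of_le hde
    refine Or.inr ⟨e', rfl, _, SetLike.coe_mem (DirectSum.decompose 𝒜 c e'), ?_⟩
    rw [← hue, mul_comm c, DirectSum.coe_decompose_mul_add_of_left_mem 𝒜 hy]
    simpa using hie
  · left
    rw [← hue, DirectSum.coe_decompose_mul_of_right_mem_of_not_le 𝒜 hy (not_le.2 hde)]
    simpa using hie

/-- A maximal member among the proper colon ideals (I : v), v homogeneous, is prime; being
homogeneous, it need only be tested on homogeneous products. -/
theorem exists_homogeneousAssociatedPrime [IsNoetherianRing A] {I : Ideal A}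
    (hI : I.IsHomogeneous 𝒜) {u : A} {e : ℕ} (hu : u ∈ 𝒜 e) (huI : u ∉ I) :
    ∃ Q ∈ homogeneousAssociatedPrimes 𝒜 I, ∀ q, q * u ∈ I → q ∈ Q := by
  let S : Set (Ideal A) := {J | I.colon {u} ≤ J ∧ ∃ e, ∃ v ∈ 𝒜 e, v ∉ I ∧ J = I.colon {v}}
  have hne : S.Nonempty := ⟨_, le_rfl, e, u, hu, huI, rfl⟩
  obtain ⟨Q, ⟨hQu, e', v, hv, hvI, rfl⟩, hmax⟩ := set_has_maximal_iff_noetherian.2 ‹_› S hne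
  have hmem : ∀ (x q : A), q ∈ I.colon {x} ↔ q * x ∈ I := fun x q => by
    rw [Submodule.mem_colon_singleton, smul_eq_mul]
  refine ⟨I.colon {v}, ⟨?_, e', v, hv, hmem v⟩, fun q hq => hQu ((hmem u q).2 hq)⟩
  have hhom : (I.colon {v}).IsHomogeneous 𝒜 := by
    intro i x hx
    rw [hmem] at hx ⊢
    rw [← DirectSum.coe_decompose_mul_add_of_right_mem 𝒜 hv]
    exact hI _ hx
  refine hhom.isPrime_of_homogeneous_mem_or_mem ?_ ?_
  · rw [Ideal.ne_top_iff_one, hmem, one_mul]; exact hvI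
  · rintro x y - ⟨k, hy⟩ hxy
    by_contra! hcon
    rw [hmem v y] at hcon
    have hle : I.colon {v} ≤ I.colon {y * v} := fun q hq => by
      rw [hmem] at hq ⊢
      rw [mul_left_comm]; exact I.mul_mem_left y hq
    have hS : I.colon {y * v} ∈ S :=
      ⟨hQu.trans hle, _, _, SetLike.mul_mem_graded hy hv, hcon.2, rfl⟩
    refine hmax _ hS (lt_of_le_of_ne hle fun heq => hcon.1 ?_)
    rw [heq, hmem, ← mul_assoc, ← hmem]
    exact hxy

theorem regularMod_of_forall_notMem [IsNoetherianRing A] {I : Ideal A}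
    (hI : I.IsHomogeneous 𝒜) {y : A} {d : ℕ} (hy : y ∈ 𝒜 d)
    (h : ∀ Q ∈ homogeneousAssociatedPrimes 𝒜 I, y ∉ Q) : RegularMod I y := by
  refine regularMod_of_homogeneous 𝒜 hI hy fun e u hu hyu => ?_
  by_contra huI
  obtain ⟨Q, hQ, hle⟩ := exists_homogeneousAssociatedPrime 𝒜 hI hu huI
  exact h Q hQ (hle y hyu)

/-- If `Q` kills a homogeneous element outside `I`, it kills one outside `I + (y)`. -/
theorem exists_notMem_sup_span {I Q : Ideal A} (hI : I.IsHomogeneous 𝒜) {y : A} {d : ℕ}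
    (hd : 0 < d) (hy : y ∈ 𝒜 d) (hreg : RegularMod I y) (e : ℕ) :
    ∀ u ∈ 𝒜 e, u ∉ I → (∀ q ∈ Q, q * u ∈ I) →
      ∃ e', ∃ v ∈ 𝒜 e', v ∉ I ⊔ Ideal.span {y} ∧ ∀ q ∈ Q, q * v ∈ I := by
  induction e using Nat.strong_induction_on with
  | _ e ih =>
    intro u hu huI hQ
    by_cases hmem : u ∈ I ⊔ Ideal.span {y}
    · rcases mem_sup_span_homogeneous 𝒜 hI hy hu hmem with h | ⟨e', rfl, v, hv, huv⟩
      · exact absurd h huI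
      · refine ih e' (by omega) v hv (fun hvI => huI ?_) fun q hq => hreg _ ?_
        · simpa using I.add_mem huv (I.mul_mem_left y hvI)
        · have h2 := I.sub_mem (hQ q hq) (I.mul_mem_left q huv)
          convert h2 using 1; ring
    · exact ⟨e, u, hu, hmem, hQ⟩

/-- Each regular element y yields a homogeneous associated prime of I + (y) strictly above Q, since
y ∉ Q; the dimension drops at least once per element. -/
theorem DepthGE.le_ringKrullDim [IsNoetherianRing A] {r : ℕ} : ∀ {I Q : Ideal A},
    I.IsHomogeneous 𝒜 → DepthGE 𝒜 r I → Q ∈ homogeneousAssociatedPrimes 𝒜 I →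
      (r : WithBot ℕ∞) ≤ ringKrullDim (A ⧸ Q) := by
  induction r with
  | zero =>
    intro I Q _ _ hQ
    have := hQ.1
    simpa using ringKrullDim_nonneg_of_nontrivial (R := A ⧸ Q)
  | succ r ih =>
    rintro I Q hI ⟨d, hd, y, hy, hreg, hdep⟩ hQ
    obtain ⟨hp, e, u, hu, hcol⟩ := id hQ
    have huI : u ∉ I := fun h => hp.ne_top ((Ideal.eq_top_iff_one _).2 ((hcol 1).2 (by simpa)))
    obtain ⟨e', v, hv, hvI, hvQ⟩ :=
      exists_notMem_sup_span 𝒜 hI hd hy hreg e u hu huI fun q hq => (hcol q).1 hq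
    have hI' := isHomogeneous_sup_span 𝒜 hI hy
    obtain ⟨Q', hQ', hle⟩ := exists_homogeneousAssociatedPrime 𝒜 hI' hv hvI
    have hlt : Q < Q' := by
      refine lt_of_le_of_ne (fun q hq => hle q (Ideal.mem_sup_left (hvQ q hq))) ?_
      rintro rfl
      refine hreg.notMem 𝒜 hQ (hle y (Ideal.mem_sup_right ?_))
      exact Ideal.mul_mem_right _ _ (Ideal.mem_span_singleton_self y)
    refine le_trans ?_ (add_one_le_ringKrullDim_quotient hp hlt)
    push_cast
    gcongr
    exact ih hI' hdep hQ'

/-- An element killed by z modulo I is y times another such element of smaller degree, so induction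
on the degree replaces Nakayama's lemma. -/
theorem RegularMod.of_sup_span {I : Ideal A} (hI : I.IsHomogeneous 𝒜) {y z : A} {d k : ℕ}
    (hd : 0 < d) (hy : y ∈ 𝒜 d) (hz : z ∈ 𝒜 k) (hyI : RegularMod I y)
    (hzI : RegularMod (I ⊔ Ideal.span {y}) z) : RegularMod I z := by
  refine regularMod_of_homogeneous 𝒜 hI hz fun e => ?_
  induction e using Nat.strong_induction_on with
  | _ e ih =>
    intro u hu huI
    rcases mem_sup_span_homogeneous 𝒜 hI hy hu (hzI u (Ideal.mem_sup_left huI)) with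
      h | ⟨e', rfl, v, hv, huv⟩
    · exact h
    · have hvI : v ∈ I := ih e' (by omega) v hv <| hyI _ <| by
        convert I.sub_mem huI (I.mul_mem_left z huv) using 1; ring
      simpa using I.add_mem huv (I.mul_mem_left y hvI)

theorem exists_homogeneous_forall_notMem [Infinite K] {s : Set (Ideal A)} (hs : s.Finite)
    (hprime : ∀ Q ∈ s, Q.IsPrime) (h : ∀ Q ∈ s, ∃ d, 0 < d ∧ ∃ v ∈ 𝒜 d, v ∉ Q) :
    ∃ d, 0 < d ∧ ∃ z ∈ 𝒜 d, ∀ Q ∈ s, z ∉ Q := by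
  choose! d hd v hv hvQ using h
  have hpos : ∀ Q ∈ hs.toFinset, 0 < d Q := fun Q hQ => hd Q (hs.mem_toFinset.1 hQ)
  -- A common multiple of the degrees: suitable powers of all the `v Q` lie in this single graded
  -- piece, where subspace avoidance applies.
  refine ⟨∏ Q ∈ hs.toFinset, d Q, Finset.prod_pos hpos, ?_⟩
  refine exists_mem_forall_notMem _ hs fun Q hQ => ?_
  obtain ⟨c, hc⟩ := Finset.dvd_prod_of_mem d (hs.mem_toFinset.2 hQ)
  refine ⟨v Q ^ c, ?_, fun hmem => hvQ Q hQ ((hprime Q hQ).mem_of_pow_mem c hmem)⟩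
  have := SetLike.pow_mem_graded (A := 𝒜) c (hv Q hQ)
  rwa [hc, mul_comm]

/-- Cutting by a homogeneous regular element lowers the depth by at most one. -/
theorem DepthGE.sup_span [Infinite K] [IsNoetherianRing A] {r : ℕ} :
    ∀ {I : Ideal A} {f : A} {d : ℕ}, I.IsHomogeneous 𝒜 → DepthGE 𝒜 (r + 1) I → 0 < d → f ∈ 𝒜 d →
      RegularMod I f → DepthGE 𝒜 r (I ⊔ Ideal.span {f}) := by
  induction r with
  | zero => intros; trivial
  | succ r ih =>
    rintro I f d hI ⟨k, hk, y, hy, hyI, hdep⟩ hd hf hfI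
    have hIf := isHomogeneous_sup_span 𝒜 hI hf
    have hIy := isHomogeneous_sup_span 𝒜 hI hy
    have hsy := hdep.socleFree 𝒜
    have hsf := hsy.exchange 𝒜 hk hy hyI hfI
    -- One z regular modulo both I + (f) and I + (y) links the two: the induction hypothesis is
    -- applied modulo y to cut by z, then modulo z to cut by f.
    obtain ⟨e, he, z, hz, hzQ⟩ := exists_homogeneous_forall_notMem 𝒜
      ((homogeneousAssociatedPrimes_finite 𝒜 (I ⊔ Ideal.span {f})).union
        (homogeneousAssociatedPrimes_finite 𝒜 (I ⊔ Ideal.span {y})))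
      (by rintro Q (hQ | hQ) <;> exact hQ.1)
      (by
        rintro Q (hQ | hQ)
        · exact hsf.exists_notMem 𝒜 hQ
        · exact hsy.exists_notMem 𝒜 hQ)
    have hzf := regularMod_of_forall_notMem 𝒜 hIf hz fun Q hQ => hzQ Q (Or.inl hQ)
    have hzy := regularMod_of_forall_notMem 𝒜 hIy hz fun Q hQ => hzQ Q (Or.inr hQ)
    have hzI := RegularMod.of_sup_span 𝒜 hI hk hy hz hyI hzy
    have hIz := isHomogeneous_sup_span 𝒜 hI hz
    have h1 : DepthGE 𝒜 r (I ⊔ Ideal.span {z} ⊔ Ideal.span {y}) := by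
      rw [sup_right_comm]; exact ih hIy hdep he hz hzy
    have h2 : DepthGE 𝒜 r (I ⊔ Ideal.span {z} ⊔ Ideal.span {f}) :=
      ih hIz ⟨k, hk, y, hy, hyI.swap hzy, h1⟩ hd hf (hfI.swap hzf)
    exact ⟨e, he, z, hz, hzf, by rwa [sup_right_comm]⟩

end GradedRegular

/-! ### Hilbert series of quotients by regular sequences -/

section HilbertSeries

variable {K A : Type*} [Field K] [CommRing A] [Algebra K A] (𝒜 : ℕ → Submodule K A)

/-- `I` is generated by a regular sequence of homogeneous elements with the given degrees. -/
inductive IsRegularIdeal : Multiset ℕ → Ideal A → Prop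
  | bot : IsRegularIdeal 0 ⊥
  | sup_span {s : Multiset ℕ} {I : Ideal A} {d : ℕ} {f : A} (h : IsRegularIdeal s I)
      (hf : f ∈ 𝒜 d) (hreg : RegularMod I f) : IsRegularIdeal (d ::ₘ s) (I ⊔ Ideal.span {f})

/-- The degree `d` part of `A ⧸ I`. -/
def gradedPiece (I : Ideal A) (d : ℕ) : Submodule K (A ⧸ I) :=
  (𝒜 d).map (Ideal.Quotient.mkₐ K I).toLinearMap

/-- The Hilbert series of `A ⧸ I`. -/
noncomputable def hilbertSeries (I : Ideal A) : PowerSeries ℤ :=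
  PowerSeries.mk fun d => (Module.finrank K (gradedPiece 𝒜 I d) : ℤ)

instance [∀ d, Module.Finite K (𝒜 d)] (I : Ideal A) (d : ℕ) :
    Module.Finite K (gradedPiece 𝒜 I d) :=
  inferInstanceAs (Module.Finite K ((𝒜 d).map (Ideal.Quotient.mkₐ K I).toLinearMap))

variable [GradedAlgebra 𝒜]

theorem IsRegularIdeal.isHomogeneous {s : Multiset ℕ} {I : Ideal A} (h : IsRegularIdeal 𝒜 s I) :
    I.IsHomogeneous 𝒜 := by
  induction h with
  | bot => exact Ideal.IsHomogeneous.bot 𝒜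
  | sup_span _ hf _ ih => exact isHomogeneous_sup_span 𝒜 ih hf

variable [∀ d, Module.Finite K (𝒜 d)]

/-- Rank–nullity for the projection from A/I to A/(I + (f)): in degree d its kernel is f times the
part of degree d - a, and multiplication by f is injective. -/
theorem finrank_gradedPiece_sup_span {I : Ideal A} (hI : I.IsHomogeneous 𝒜) {f : A} {a : ℕ}
    (hf : f ∈ 𝒜 a) (hreg : RegularMod I f) (d : ℕ) :
    Module.finrank K (gradedPiece 𝒜 (I ⊔ Ideal.span {f}) d) +
      (if a ≤ d then Module.finrank K (gradedPiece 𝒜 I (d - a)) else 0) =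
      Module.finrank K (gradedPiece 𝒜 I d) := by
  have hle : I ≤ I ⊔ Ideal.span {f} := le_sup_left
  let π : A ⧸ I →ₗ[K] A ⧸ (I ⊔ Ideal.span {f}) := (Ideal.Quotient.factorₐ K hle).toLinearMap
  let φ := π.domRestrict (gradedPiece 𝒜 I d)
  have hrange : LinearMap.range φ = gradedPiece 𝒜 (I ⊔ Ideal.span {f}) d := by
    rw [LinearMap.range_domRestrict, gradedPiece, ← Submodule.map_comp]
    rfl
  have hker : Module.finrank K (LinearMap.ker φ) =
      if a ≤ d then Module.finrank K (gradedPiece 𝒜 I (d - a)) else 0 := by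
    have hmul : Function.Injective (LinearMap.mulLeft K (Ideal.Quotient.mk I f)) := by
      rw [← LinearMap.ker_eq_bot, LinearMap.ker_eq_bot']
      intro x hx
      obtain ⟨u, rfl⟩ := Ideal.Quotient.mk_surjective x
      rw [LinearMap.mulLeft_apply, ← map_mul, Ideal.Quotient.eq_zero_iff_mem] at hx
      exact Ideal.Quotient.eq_zero_iff_mem.2 (hreg u hx)
    have hzero : ∀ x : LinearMap.ker φ, ∃ u ∈ 𝒜 d, Ideal.Quotient.mk I u = x.1 ∧
        u ∈ I ⊔ Ideal.span {f} := by
      rintro ⟨⟨x, u, hu, rfl⟩, hx⟩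
      exact ⟨u, hu, rfl, Ideal.Quotient.eq_zero_iff_mem.1 hx⟩
    split_ifs with had
    · have heq : (LinearMap.ker φ).map (gradedPiece 𝒜 I d).subtype =
          LinearMap.range ((LinearMap.mulLeft K (Ideal.Quotient.mk I f)).domRestrict
            (gradedPiece 𝒜 I (d - a))) := by
        ext x
        constructor
        · rintro ⟨x, hx, rfl⟩
          obtain ⟨u, hu, hux, hmem⟩ := hzero ⟨x, hx⟩
          rcases mem_sup_span_homogeneous 𝒜 hI hf hu hmem with h | ⟨e, rfl, v, hv, huv⟩
          · refine ⟨0, ?_⟩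
            rw [map_zero, ← Ideal.Quotient.eq_zero_iff_mem.2 h]
            exact hux
          · refine ⟨⟨Ideal.Quotient.mk I v, v, ?_, rfl⟩, ?_⟩
            · rwa [Nat.add_sub_cancel_left]
            · rw [← Ideal.Quotient.mk_eq_mk_iff_sub_mem, map_mul] at huv
              exact huv.symm.trans hux
        · rintro ⟨⟨y, v, hv, rfl⟩, rfl⟩
          refine ⟨⟨Ideal.Quotient.mk I (f * v), f * v, ?_, rfl⟩, ?_, rfl⟩
          · have := SetLike.mul_mem_graded hf hv
            rwa [Nat.add_sub_cancel' had] at this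
          · refine Ideal.Quotient.eq_zero_iff_mem.2 (Ideal.mem_sup_right ?_)
            exact Ideal.mul_mem_right _ _ (Ideal.mem_span_singleton_self f)
      rw [← Submodule.finrank_map_subtype_eq, heq]
      exact LinearMap.finrank_range_of_inj fun x y h => Subtype.ext (hmul h)
    · have : LinearMap.ker φ = ⊥ := by
        rw [Submodule.eq_bot_iff]
        intro x hx
        obtain ⟨u, hu, hux, hmem⟩ := hzero ⟨x, hx⟩
        rcases mem_sup_span_homogeneous 𝒜 hI hf hu hmem with h | ⟨e, he, -⟩
        · exact Subtype.ext (hux.symm.trans (Ideal.Quotient.eq_zero_iff_mem.2 h))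
        · omega
      rw [this, finrank_bot]
  rw [← hker, ← hrange]
  exact LinearMap.finrank_range_add_finrank_ker φ

theorem hilbertSeries_sup_span {I : Ideal A} (hI : I.IsHomogeneous 𝒜) {f : A} {a : ℕ}
    (hf : f ∈ 𝒜 a) (hreg : RegularMod I f) :
    hilbertSeries 𝒜 (I ⊔ Ideal.span {f}) = hilbertSeries 𝒜 I * (1 - PowerSeries.X ^ a) := by
  ext d
  rw [mul_sub, mul_one, map_sub, PowerSeries.coeff_mul_X_pow', hilbertSeries, hilbertSeries,
    PowerSeries.coeff_mk, PowerSeries.coeff_mk, eq_sub_iff_add_eq, PowerSeries.coeff_mk,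
    ← finrank_gradedPiece_sup_span 𝒜 hI hf hreg d]
  split_ifs <;> simp

theorem IsRegularIdeal.hilbertSeries_eq {s : Multiset ℕ} {I : Ideal A}
    (h : IsRegularIdeal 𝒜 s I) :
    hilbertSeries 𝒜 I =
      hilbertSeries 𝒜 ⊥ * (s.map fun d => (1 - PowerSeries.X ^ d : PowerSeries ℤ)).prod := by
  induction h with
  | bot => simp
  | sup_span h hf hreg ih =>
    rw [hilbertSeries_sup_span 𝒜 (h.isHomogeneous 𝒜) hf hreg, ih, Multiset.map_cons,
      Multiset.prod_cons, mul_assoc, mul_comm (Multiset.prod _)]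

end HilbertSeries

/-! ### Weighted polynomial rings -/

section WeightedPolynomialRing

open MvPolynomial

attribute [local instance] MvPolynomial.weightedGradedAlgebra

variable {K σ : Type*} [Field K] (w : σ → ℕ)

theorem regularMod_span_X_image {s : Set σ} {i : σ} (hi : i ∉ s) :
    RegularMod (Ideal.span (X '' s : Set (MvPolynomial σ K))) (X i) := by
  classical
  intro u hu
  rw [mem_ideal_span_X_image] at hu ⊢
  intro m hm
  obtain ⟨j, hj, hmj⟩ := hu (Finsupp.single i 1 + m) (by
    rw [MvPolynomial.mem_support_iff, MvPolynomial.coeff_X_mul]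
    exact MvPolynomial.mem_support_iff.1 hm)
  refine ⟨j, hj, ?_⟩
  have hij : i ≠ j := fun h => hi (h ▸ hj)
  simpa [Finsupp.single_apply, hij] using hmj

theorem span_X_insert (s : Set σ) (i : σ) :
    Ideal.span (X '' insert i s : Set (MvPolynomial σ K)) =
      Ideal.span (X '' s) ⊔ Ideal.span {X i} := by
  rw [Set.image_insert_eq, Ideal.span_insert, sup_comm]

theorem isRegularIdeal_span_X (T : Finset σ) :
    IsRegularIdeal (weightedHomogeneousSubmodule K w) (T.val.map w)
      (Ideal.span (X '' (T : Set σ))) := by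
  classical
  induction T using Finset.induction_on with
  | empty => simpa using IsRegularIdeal.bot
  | insert i T hi ih =>
    rw [Finset.insert_val_of_notMem hi, Multiset.map_cons, Finset.coe_insert, span_X_insert]
    exact ih.sup_span (isWeightedHomogeneous_X K w i) (regularMod_span_X_image (by simpa using hi))

theorem depthGE_span_X_compl (hw : ∀ i, 0 < w i) (T : Finset σ) :
    DepthGE (weightedHomogeneousSubmodule K w) T.card (Ideal.span (X '' (T : Set σ)ᶜ)) := by
  classical
  induction T using Finset.induction_on with
  | empty => trivial
  | insert i T hi ih =>
    rw [Finset.card_insert_of_notMem hi]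
    refine ⟨w i, hw i, X i, isWeightedHomogeneous_X K w i, regularMod_span_X_image (by simp), ?_⟩
    rw [← span_X_insert]
    rwa [show insert i ((insert i T : Finset σ) : Set σ)ᶜ = (T : Set σ)ᶜ by
      ext j
      by_cases h : j = i <;> simp [h, hi]]

theorem finite_weightedHomogeneousSubmodule [Finite σ] (hw : ∀ i, 0 < w i) (d : ℕ) :
    Module.Finite K (weightedHomogeneousSubmodule K w d) :=
  Module.Finite.iff_fg.2 (weightedHomogeneousSubmodule_fg K w (fun i => (hw i).ne') d)

/-- The quotient is K in degree 0. As the variables form a regular sequence, this determines the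
Hilbert series of the polynomial ring without counting monomials. -/
theorem hilbertSeries_span_X [Finite σ] (hw : ∀ i, 0 < w i) :
    hilbertSeries (weightedHomogeneousSubmodule K w) (Ideal.span (X '' Set.univ)) = 1 := by
  classical
  have := finite_weightedHomogeneousSubmodule (K := K) w hw
  ext d
  rw [hilbertSeries, PowerSeries.coeff_mk, PowerSeries.coeff_one]
  split_ifs with hd
  · subst hd
    have h1 : (1 : MvPolynomial σ K ⧸ Ideal.span (X '' Set.univ : Set (MvPolynomial σ K))) ≠ 0 := by
      rw [← map_one (Ideal.Quotient.mk _), Ne, Ideal.Quotient.eq_zero_iff_mem,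
        mem_ideal_span_X_image]
      intro h
      obtain ⟨i, -, hi⟩ := h 0 (by simp)
      exact hi rfl
    have hspan : gradedPiece (weightedHomogeneousSubmodule K w) (Ideal.span (X '' Set.univ)) 0 =
        K ∙ 1 := by
      refine le_antisymm ?_ ?_
      · rintro _ ⟨u, hu, rfl⟩
        refine Submodule.mem_span_singleton.2 ⟨MvPolynomial.coeff 0 u, ?_⟩
        rw [Algebra.smul_def, mul_one]
        refine Ideal.Quotient.eq.2 (mem_ideal_span_X_image.2 fun m hm => ?_)
        by_contra! hcon
        rw [show m = 0 from Finsupp.ext fun i => hcon i (Set.mem_univ i)] at hm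
        simp at hm
      · rw [Submodule.span_singleton_le_iff_mem]
        exact ⟨1, isWeightedHomogeneous_one K w, map_one (Ideal.Quotient.mk _)⟩
    rw [hspan, finrank_span_singleton h1, Nat.cast_one]
  · have : gradedPiece (weightedHomogeneousSubmodule K w) (Ideal.span (X '' Set.univ)) d = ⊥ := by
      rw [Submodule.eq_bot_iff]
      rintro _ ⟨u, hu, rfl⟩
      refine Ideal.Quotient.eq_zero_iff_mem.2 (mem_ideal_span_X_image.2 fun m hm => ?_)
      by_contra! hcon
      refine hd ?_
      rw [← hu (MvPolynomial.mem_support_iff.1 hm),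
        show m = 0 from Finsupp.ext fun i => hcon i (Set.mem_univ i), map_zero]
    rw [this, finrank_bot, Nat.cast_zero]

theorem ringKrullDim_quotient_le_card [Fintype σ] (P : Ideal (MvPolynomial σ K)) (s : Finset σ)
    (hs : ∀ i, i ∉ s → X i ∈ P) : ringKrullDim (MvPolynomial σ K ⧸ P) ≤ s.card := by
  let g : MvPolynomial s K →ₐ[K] MvPolynomial σ K ⧸ P :=
    aeval fun i => Ideal.Quotient.mk P (X i)
  have hg : Function.Surjective g := by
    intro x
    obtain ⟨p, rfl⟩ := Ideal.Quotient.mk_surjective x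
    change _ ∈ g.range
    induction p using MvPolynomial.induction_on with
    | C c => exact ⟨C c, by simp [g]; rfl⟩
    | add p q hp hq => rw [map_add]; exact add_mem hp hq
    | mul_X p i hp =>
      rw [map_mul]
      refine mul_mem hp ?_
      by_cases hi : i ∈ s
      · exact ⟨X ⟨i, hi⟩, by simp [g]⟩
      · rw [Ideal.Quotient.eq_zero_iff_mem.2 (hs i hi)]; exact zero_mem _
  refine (ringKrullDim_le_of_surjective g.toRingHom hg).trans ?_
  rw [MvPolynomial.ringKrullDim_of_isNoetherianRing]
  simp

theorem exists_weightedHomogeneous_notMem {P : Ideal (MvPolynomial σ K)} (hP : P.IsPrime)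
    {s : Set σ} (hs : ∀ i ∈ s, X i ∉ P) {d : ℕ} (hd : d ∈ AddSubmonoid.closure (w '' s)) :
    ∃ v ∈ weightedHomogeneousSubmodule K w d, v ∉ P := by
  induction hd using AddSubmonoid.closure_induction with
  | mem x hx =>
    obtain ⟨i, hi, rfl⟩ := hx
    exact ⟨X i, isWeightedHomogeneous_X K w i, hs i hi⟩
  | zero =>
    exact ⟨1, isWeightedHomogeneous_one K w, fun h => hP.ne_top ((Ideal.eq_top_iff_one _).2 h)⟩
  | add x y _ _ hx hy =>
    obtain ⟨v, hv, hvP⟩ := hx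
    obtain ⟨u, hu, huP⟩ := hy
    exact ⟨v * u, hv.mul hu, fun h => (hP.mem_or_mem h).elim hvP huP⟩

end WeightedPolynomialRing

/-! ### Regular sequences of prescribed degrees -/

section RegularSequenceExistence

open MvPolynomial

attribute [local instance] MvPolynomial.weightedGradedAlgebra

variable {K σ : Type*} [Field K]

open Classical in
/-- The number of `a j`, for `j ∈ T`, in the semigroup generated by the `b i`, `i ∈ s`. -/
noncomputable def semigroupCount (a b : σ → ℕ) (T s : Finset σ) : ℕ :=
  (T.filter fun j => a j ∈ AddSubmonoid.closure (b '' (s : Set σ))).card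

open Classical in
theorem semigroupCount_insert (a b : σ → ℕ) {T : Finset σ} (s : Finset σ) {j : σ} (hj : j ∉ T) :
    semigroupCount a b (insert j T) s = semigroupCount a b T s +
      if a j ∈ AddSubmonoid.closure (b '' (s : Set σ)) then 1 else 0 := by
  unfold semigroupCount
  rw [Finset.filter_insert]
  split_ifs
  · exact Finset.card_insert_of_notMem (by simp [hj])
  · simp

variable [Fintype σ]

open Classical in
/-- The indices of the variables outside `P`. -/
noncomputable def variableSupport (P : Ideal (MvPolynomial σ K)) : Finset σ :=
  {i | X i ∉ P}

theorem mem_variableSupport {P : Ideal (MvPolynomial σ K)} {i : σ} :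
    i ∈ variableSupport P ↔ X i ∉ P := by
  simp [variableSupport]

theorem semigroupCount_univ_le (a b : σ → ℕ) (T s : Finset σ) :
    semigroupCount a b Finset.univ s + T.card ≤ semigroupCount a b T s + Fintype.card σ := by
  classical
  unfold semigroupCount
  rw [← Finset.card_add_card_compl T, ← Finset.union_compl T, Finset.filter_union]
  have h1 := Finset.card_union_le (T.filter fun j => a j ∈ AddSubmonoid.closure (b '' (s : Set σ)))
    (Tᶜ.filter fun j => a j ∈ AddSubmonoid.closure (b '' (s : Set σ)))
  have h2 := Finset.card_filter_le Tᶜ fun j => a j ∈ AddSubmonoid.closure (b '' (s : Set σ))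
  omega

theorem exists_regular_step [Infinite K] {a b : σ → ℕ}
    (hgood : ∀ s : Finset σ, s.card ≤ semigroupCount a b Finset.univ s)
    {T : Finset σ} {j : σ} (hj : j ∉ T) {I : Ideal (MvPolynomial σ K)}
    (hI : I.IsHomogeneous (weightedHomogeneousSubmodule K b))
    (hdep : DepthGE (weightedHomogeneousSubmodule K b) (Fintype.card σ - T.card) I)
    (hdim : ∀ P : Ideal (MvPolynomial σ K), P.IsPrime → I ≤ P →
      ringKrullDim (MvPolynomial σ K ⧸ P) + (semigroupCount a b T (variableSupport P) : ℕ) ≤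
        (variableSupport P).card) :
    ∃ f ∈ weightedHomogeneousSubmodule K b (a j), RegularMod I f ∧
      ∀ s : Finset σ, ∀ Q ∈ (I ⊔ Ideal.span (X '' (s : Set σ)ᶜ)).minimalPrimes,
        a j ∈ AddSubmonoid.closure (b '' (variableSupport Q : Set σ)) → f ∉ Q := by
  classical
  -- Depth gives n - #T ≤ dim A/Q. If a_j were outside the semigroup of Q, `hdim` and `hgood` would
  -- leave only n - #T - 1 indices outside T ∪ {j} to account for n - #T elements.
  have hA : ∀ Q ∈ homogeneousAssociatedPrimes (weightedHomogeneousSubmodule K b) I,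
      a j ∈ AddSubmonoid.closure (b '' (variableSupport Q : Set σ)) := by
    intro Q hQ
    have h1 := hdep.le_ringKrullDim (weightedHomogeneousSubmodule K b) hI hQ
    have h2 := hdim Q hQ.1 (le_of_mem_homogeneousAssociatedPrimes _ hQ)
    have h3 : ((Fintype.card σ - T.card : ℕ) : WithBot ℕ∞) +
        (semigroupCount a b T (variableSupport Q) : ℕ) ≤ (variableSupport Q).card :=
      (add_le_add_left h1 _).trans h2
    have h4 : Fintype.card σ - T.card + semigroupCount a b T (variableSupport Q) ≤
      (variableSupport Q).card := by exact_mod_cast h3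
    have h5 := hgood (variableSupport Q)
    have h6 := semigroupCount_univ_le a b (insert j T) (variableSupport Q)
    rw [semigroupCount_insert a b _ hj, Finset.card_insert_of_notMem hj] at h6
    by_contra hcon
    rw [if_neg hcon] at h6
    omega
  -- Avoiding the associated primes gives regularity; avoiding the minimal primes preserves the
  -- dimension bound.
  obtain ⟨f, hf, hfQ⟩ := exists_mem_forall_notMem (weightedHomogeneousSubmodule K b (a j))
    (s := homogeneousAssociatedPrimes (weightedHomogeneousSubmodule K b) I ∪
      {Q | (∃ s : Finset σ, Q ∈ (I ⊔ Ideal.span (X '' (s : Set σ)ᶜ)).minimalPrimes) ∧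
        a j ∈ AddSubmonoid.closure (b '' (variableSupport Q : Set σ))})
    ((homogeneousAssociatedPrimes_finite _ I).union
      ((Set.finite_iUnion fun s : Finset σ => Ideal.finite_minimalPrimes_of_isNoetherianRing _
        (I ⊔ Ideal.span (X '' (s : Set σ)ᶜ))).subset fun Q hQ => Set.mem_iUnion.2 hQ.1))
    (by
      rintro Q (hQ | ⟨⟨s, hQ⟩, hcl⟩)
      · exact exists_weightedHomogeneous_notMem b hQ.1 (fun i hi => mem_variableSupport.1 hi)
          (hA Q hQ)
      · exact exists_weightedHomogeneous_notMem b hQ.1.1 (fun i hi => mem_variableSupport.1 hi) hcl)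
  exact ⟨f, hf, regularMod_of_forall_notMem _ hI hf fun Q hQ => hfQ Q (Or.inl hQ),
    fun s Q hQ hcl => hfQ Q (Or.inr ⟨⟨s, hQ⟩, hcl⟩)⟩

/-- Existence of weighted homogeneous regular sequences of prescribed degrees. -/
theorem exists_isRegularIdeal (K : Type*) [Field K] [Infinite K] {a b : σ → ℕ} (ha : ∀ i, 0 < a i)
    (hb : ∀ i, 0 < b i) (hgood : ∀ s : Finset σ, s.card ≤ semigroupCount a b Finset.univ s) :
    ∃ I, IsRegularIdeal (weightedHomogeneousSubmodule K b) (Finset.univ.val.map a) I := by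
  classical
  suffices h : ∀ T : Finset σ, ∃ I, IsRegularIdeal (weightedHomogeneousSubmodule K b)
      (T.val.map a) I ∧
      DepthGE (weightedHomogeneousSubmodule K b) (Fintype.card σ - T.card) I ∧
      ∀ P : Ideal (MvPolynomial σ K), P.IsPrime → I ≤ P →
        ringKrullDim (MvPolynomial σ K ⧸ P) + (semigroupCount a b T (variableSupport P) : ℕ) ≤
          (variableSupport P).card by
    obtain ⟨I, hI, -⟩ := h Finset.univ
    exact ⟨I, hI⟩
  intro T
  induction T using Finset.induction_on with
  | empty =>
    refine ⟨⊥, IsRegularIdeal.bot, ?_, fun P hP _ => ?_⟩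
    · simpa using depthGE_span_X_compl (K := K) b hb Finset.univ
    · simpa [semigroupCount] using ringKrullDim_quotient_le_card P (variableSupport P)
        fun i hi => by simpa [mem_variableSupport] using hi
  | insert j T hj ih =>
    obtain ⟨I, hI, hdep, hdim⟩ := ih
    have hhom := hI.isHomogeneous
    obtain ⟨f, hf, hreg, hmin⟩ := exists_regular_step hgood hj hhom hdep hdim
    have hcard : Fintype.card σ - T.card = Fintype.card σ - (insert j T).card + 1 := by
      have := Finset.card_le_univ (insert j T)
      rw [Finset.card_insert_of_notMem hj] at this ⊢
      omega
    rw [hcard] at hdep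
    refine ⟨I ⊔ Ideal.span {f}, ?_, hdep.sup_span _ hhom (ha j) hf hreg, fun P hP hle => ?_⟩
    · rw [Finset.insert_val_of_notMem hj, Multiset.map_cons]
      exact hI.sup_span hf hreg
    · have hIP : I ≤ P := le_sup_left.trans hle
      rw [semigroupCount_insert a b _ hj]
      split_ifs with hcl
      -- The count grows by one, so dim A/P must have one to spare. A minimal prime Q ≤ P over I and
      -- the variables in P has the same support as P but omits f, so Q < P, and the old bound at Q
      -- suffices.
      · have hJ : I ⊔ Ideal.span (X '' ((variableSupport P : Finset σ) : Set σ)ᶜ) ≤ P := by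
          refine sup_le hIP (Ideal.span_le.2 ?_)
          rintro _ ⟨i, hi, rfl⟩
          simpa [mem_variableSupport] using hi
        obtain ⟨Q, hQ, hQP⟩ := Ideal.exists_minimalPrimes_le hJ
        have hsupp : variableSupport Q = variableSupport P := by
          ext i
          refine ⟨fun hi => ?_, fun hi => ?_⟩
          · by_contra hiP
            exact mem_variableSupport.1 hi (hQ.1.2 (Ideal.mem_sup_right
              (Ideal.subset_span ⟨i, by simpa using hiP, rfl⟩)))
          · exact mem_variableSupport.2 fun h => mem_variableSupport.1 hi (hQP h)
        have hfQ : f ∉ Q := hmin _ Q hQ (by rwa [hsupp])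
        have hlt : Q < P := lt_of_le_of_ne hQP fun h => hfQ <| h ▸
          hle (Ideal.mem_sup_right (Ideal.mem_span_singleton_self f))
        have h1 := add_one_le_ringKrullDim_quotient hQ.1.1 hlt
        have h2 := hdim Q hQ.1.1 (le_sup_left.trans hQ.1.2)
        rw [hsupp] at h2
        refine le_trans ?_ h2
        rw [Nat.cast_add, Nat.cast_one, add_comm ((semigroupCount a b T _ : ℕ) : WithBot ℕ∞),
          ← add_assoc]
        gcongr
      · simpa using hdim P hP hIP

/-- A quotient of products of `1 - q ^ a` by `1 - q ^ b` is the Hilbert series of a weighted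
complete intersection. -/
theorem exists_nonneg_powerSeries {a b : σ → ℕ} (ha : ∀ i, 0 < a i) (hb : ∀ i, 0 < b i)
    (hgood : ∀ s : Finset σ, s.card ≤ semigroupCount a b Finset.univ s) :
    ∃ H : PowerSeries ℤ, (∀ k, 0 ≤ PowerSeries.coeff k H) ∧
      H * ∏ i, (1 - PowerSeries.X ^ b i) = ∏ i, (1 - PowerSeries.X ^ a i) := by
  have := finite_weightedHomogeneousSubmodule (K := ℚ) b hb
  obtain ⟨I, hI⟩ := exists_isRegularIdeal ℚ ha hb hgood
  have h1 := hI.hilbertSeries_eq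
  have h2 := (isRegularIdeal_span_X (K := ℚ) b Finset.univ).hilbertSeries_eq
  rw [Finset.coe_univ, hilbertSeries_span_X b hb] at h2
  rw [Multiset.map_map] at h1 h2
  refine ⟨hilbertSeries (weightedHomogeneousSubmodule ℚ b) I, fun k => ?_, ?_⟩
  · rw [hilbertSeries, PowerSeries.coeff_mk]
    positivity
  · change _ = hilbertSeries (weightedHomogeneousSubmodule ℚ b) ⊥ *
      ∏ i, (1 - PowerSeries.X ^ a i) at h1
    change _ = hilbertSeries (weightedHomogeneousSubmodule ℚ b) ⊥ *
      ∏ i, (1 - PowerSeries.X ^ b i) at h2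
    rw [h1, mul_right_comm, ← h2, one_mul]

end RegularSequenceExistence

/-! ### Divisibility counts from roots of unity -/

section Divisibility

theorem count_roots_one_sub_X_pow {d m : ℕ} {ζ : ℂ} (hζ : IsPrimitiveRoot ζ d) (hm : 0 < m) :
    (1 - X ^ m : ℂ[X]).roots.count ζ = if d ∣ m then 1 else 0 := by
  classical
  have hne : (X ^ m - 1 : ℂ[X]) ≠ 0 := X_pow_sub_C_ne_zero hm 1
  have hnd : (X ^ m - 1 : ℂ[X]).roots.Nodup :=
    nodup_roots (separable_X_pow_sub_C (1 : ℂ) (by exact_mod_cast hm.ne') one_ne_zero)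
  rw [← neg_sub, roots_neg, Multiset.count_eq_of_nodup hnd]
  congr 1
  rw [mem_roots hne, IsRoot.def, ← hζ.pow_eq_one_iff_dvd]
  simp [sub_eq_zero]

/-- If `∏ (1 - q ^ b i)` divides `∏ (1 - q ^ a i)`, then every `d` divides at least as many of the
`a i` as of the `b i`. -/
theorem card_dvd_le_of_prod_dvd {ι : Type*} [Fintype ι] {a b : ι → ℕ} (ha : ∀ i, 0 < a i)
    (hb : ∀ i, 0 < b i) (h : (∏ i, (1 - X ^ b i) : ℤ[X]) ∣ ∏ i, (1 - X ^ a i)) {d : ℕ}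
    (hd : 0 < d) :
    (Finset.univ.filter fun i => d ∣ b i).card ≤ (Finset.univ.filter fun i => d ∣ a i).card := by
  classical
  obtain ⟨ζ, hζ⟩ : ∃ ζ : ℂ, IsPrimitiveRoot ζ d := ⟨_, Complex.isPrimitiveRoot_exp d hd.ne'⟩
  have hne : ∀ {c : ι → ℕ}, (∀ i, 0 < c i) → (∏ i, (1 - X ^ c i) : ℂ[X]) ≠ 0 := fun {c} hc => by
    refine Finset.prod_ne_zero_iff.2 fun i _ => ?_
    rw [← neg_sub, neg_ne_zero]
    exact X_pow_sub_C_ne_zero (hc i) 1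
  have hcount : ∀ {c : ι → ℕ}, (∀ i, 0 < c i) →
      (∏ i, (1 - X ^ c i) : ℂ[X]).roots.count ζ = (Finset.univ.filter fun i => d ∣ c i).card := by
    intro c hc
    rw [roots_prod _ _ (hne hc), Multiset.count_bind, Finset.card_filter]
    exact Finset.sum_congr rfl fun i _ => count_roots_one_sub_X_pow hζ (hc i)
  have hdvd := map_dvd (mapRingHom (Int.castRingHom ℂ)) h
  simp only [map_prod, map_sub, map_one, map_pow, coe_mapRingHom, map_X] at hdvd
  rw [← hcount ha, ← hcount hb]
  exact Multiset.count_le_of_le ζ (roots.le_of_dvd (hne ha) hdvd)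

end Divisibility

/-! ### Schur's bound for numerical semigroups -/

section Frobenius

/-- The gcd of the generators is congruent to an element of the semigroup. -/
theorem exists_mem_closure_modEq_gcd {ι : Type*} (b : ι → ℕ) (s : Finset ι) {c : ℕ} (hc : 0 < c) :
    ∃ N ∈ AddSubmonoid.closure (b '' (s : Set ι)), N ≡ s.gcd b [MOD c] := by
  classical
  induction s using Finset.induction_on with
  | empty => exact ⟨0, zero_mem _, by simp; rfl⟩
  | insert i s hi ih =>
    obtain ⟨N, hN, hmod⟩ := ih
    have hc' : (c : ℤ) ≠ 0 := by exact_mod_cast hc.ne'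
    -- Bézout coefficients may be negative; modulo c they have non-negative representatives.
    have hnn : ∀ u : ℤ, ∃ k : ℕ, (k : ℤ) ≡ u [ZMOD c] := fun u =>
      ⟨(u % c).toNat, by rw [Int.toNat_of_nonneg (Int.emod_nonneg u hc')]; exact Int.mod_modEq u c⟩
    obtain ⟨u, hu⟩ := hnn (Nat.gcdA (b i) (s.gcd b))
    obtain ⟨v, hv⟩ := hnn (Nat.gcdB (b i) (s.gcd b))
    refine ⟨u • b i + v • N, add_mem
      (nsmul_mem (AddSubmonoid.subset_closure (Set.mem_image_of_mem b (by simp))) u)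
      (nsmul_mem (AddSubmonoid.closure_mono (Set.image_mono (by simp)) hN) v), ?_⟩
    rw [Finset.gcd_insert, ← Int.natCast_modEq_iff]
    change _ ≡ ((Nat.gcd (b i) (s.gcd b) : ℕ) : ℤ) [ZMOD c]
    rw [Nat.gcd_eq_gcd_ab, smul_eq_mul, smul_eq_mul, Nat.cast_add, Nat.cast_mul, Nat.cast_mul,
      mul_comm (u : ℤ), mul_comm (v : ℤ)]
    exact (hu.mul_left _).add ((Int.natCast_modEq_iff.2 hmod).mul hv)

/-- A long list of multiples of `g` can be shortened without changing its sum modulo `g * q`. -/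
theorem exists_shorter_list {g q : ℕ} (hq : 0 < q) {l : List ℕ} (hg : ∀ y ∈ l, g ∣ y)
    (hl : q ≤ l.length) : ∃ l' : List ℕ, (∀ y ∈ l', y ∈ l) ∧ l'.length < l.length ∧
      l'.sum ≡ l.sum [MOD g * q] := by
  have hdvd : ∀ t, g ∣ (l.take t).sum := fun t =>
    List.dvd_sum fun y hy => hg y (List.mem_of_mem_take hy)
  -- Pigeonhole on q + 1 prefix sums, divided by g, modulo q; the block between two equal ones can
  -- be deleted.
  obtain ⟨t₁, ht₁, t₂, ht₂, hne, heq⟩ := Finset.exists_ne_map_eq_of_card_lt_of_maps_to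
    (s := Finset.range (q + 1)) (t := Finset.range q) (by simp)
    (f := fun t => (l.take t).sum / g % q)
    (fun t _ => Finset.mem_coe.2 (Finset.mem_range.2 (Nat.mod_lt _ hq)))
  wlog hlt : t₁ < t₂ generalizing t₁ t₂
  · exact this t₂ ht₂ t₁ ht₁ hne.symm heq.symm (by omega)
  rw [Finset.mem_range] at ht₁ ht₂
  have hmod : (l.take t₁).sum ≡ (l.take t₂).sum [MOD g * q] := by
    have h : (l.take t₁).sum / g ≡ (l.take t₂).sum / g [MOD q] := heq
    have := h.mul_left' g
    rwa [Nat.mul_div_cancel' (hdvd _), Nat.mul_div_cancel' (hdvd _)] at this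
  refine ⟨l.take t₁ ++ l.drop t₂, fun y hy => ?_, ?_, ?_⟩
  · rcases List.mem_append.1 hy with h | h
    · exact List.mem_of_mem_take h
    · exact List.mem_of_mem_drop h
  · rw [List.length_append, List.length_take, List.length_drop]; omega
  · rw [List.sum_append, ← List.sum_take_add_sum_drop l t₂]
    exact hmod.add_right _

/-- Schur's bound for the Frobenius number. -/
theorem mem_closure_of_schur_bound {ι : Type*} {b : ι → ℕ} {s : Finset ι} {i₀ : ι} (hi₀ : i₀ ∈ s)
    (hpos : 0 < b i₀) {M : ℕ} (hM : ∀ i ∈ s, b i ≤ M) {x : ℕ} (hx : s.gcd b ∣ x)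
    (hlt : (b i₀ / s.gcd b - 1) * M < x + b i₀) :
    x ∈ AddSubmonoid.closure (b '' (s : Set ι)) := by
  classical
  set g := s.gcd b with hg
  obtain ⟨q, hq⟩ : g ∣ b i₀ := Finset.gcd_dvd hi₀
  have hg0 : 0 < g := Nat.pos_of_ne_zero fun h => by simp [h] at hq; omega
  have hq0 : 0 < q := Nat.pos_of_ne_zero fun h => by simp [h] at hq; omega
  rw [hq, Nat.mul_div_cancel_left q hg0] at hlt
  obtain ⟨N, hN, hmod⟩ := exists_mem_closure_modEq_gcd b s hpos
  obtain ⟨k, hk⟩ := hx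
  -- A shortest list of generators representing x modulo g * q = b i₀ has at most q - 1 terms; if
  -- its sum is at most x, copies of b i₀ make up the difference.
  have hex : ∃ m, ∃ l : List ℕ, (∀ y ∈ l, y ∈ b '' (s : Set ι)) ∧ l.sum ≡ x [MOD g * q] ∧
      l.length = m := by
    obtain ⟨l, hl, hsum⟩ := AddSubmonoid.exists_list_of_mem_closure (nsmul_mem hN k)
    refine ⟨_, l, hl, ?_, rfl⟩
    rw [hsum, ← hq, hk, smul_eq_mul, mul_comm g]
    exact hmod.mul_left k
  obtain ⟨l, hl, hlx, hlen⟩ := Nat.find_spec hex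
  have hlq : l.length ≤ q - 1 := by
    by_contra! hcon
    obtain ⟨l', hl', hlen', hsum'⟩ := exists_shorter_list (g := g) (l := l) hq0 (fun y hy => by
      obtain ⟨i, hi, rfl⟩ := hl y hy
      exact Finset.gcd_dvd hi) (by omega)
    exact Nat.find_min hex (hlen ▸ hlen') ⟨l', fun y hy => hl y (hl' y hy), hsum'.trans hlx, rfl⟩
  have hsum : l.sum ≤ (q - 1) * M := by
    refine (List.sum_le_card_nsmul l M fun y hy => ?_).trans (by
      rw [smul_eq_mul]; exact Nat.mul_le_mul_right M hlq)
    obtain ⟨i, hi, rfl⟩ := hl y hy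
    exact hM i hi
  -- Otherwise the congruence forces l.sum ≥ x + b i₀, against l.sum ≤ (q - 1) * M < x + b i₀.
  have hle : l.sum ≤ x := by
    by_contra! hcon
    obtain ⟨t, ht⟩ := (Nat.modEq_iff_dvd' hcon.le).1 hlx.symm
    have : 1 ≤ t := Nat.one_le_iff_ne_zero.2 fun h => by simp [h] at ht; omega
    have := Nat.mul_le_mul_left (g * q) this
    omega
  obtain ⟨t, ht⟩ := (Nat.modEq_iff_dvd' hle).1 hlx
  have hxeq : x = l.sum + t • b i₀ := by rw [hq, smul_eq_mul, mul_comm t]; omega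
  rw [hxeq]
  exact add_mem (AddSubmonoid.list_sum_mem _ fun y hy => AddSubmonoid.subset_closure (hl y hy))
    (nsmul_mem (AddSubmonoid.subset_closure (Set.mem_image_of_mem b hi₀)) t)

end Frobenius

/-! ### The semigroup condition and the main theorem -/

section Main

theorem algebraMap_prod_one_sub_X_pow {n : ℕ} (c : Fin n → ℕ) :
    algebraMap ℤ[X] (RatFunc ℤ) (∏ i, (1 - X ^ c i)) = ∏ i, (1 - RatFunc.X ^ c i) := by
  simp [map_prod]

theorem algebraMap_eq_qQuotient_iff {n : ℕ} {a b : Fin n → ℕ} (hb : ∀ i, 0 < b i) {P : ℤ[X]} :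
    algebraMap ℤ[X] (RatFunc ℤ) P = qQuotient a b ↔
      P * ∏ i, (1 - X ^ b i) = ∏ i, (1 - X ^ a i) := by
  have hne : (∏ i, (1 - X ^ b i) : ℤ[X]) ≠ 0 := by
    refine Finset.prod_ne_zero_iff.2 fun i _ => ?_
    rw [← neg_sub, neg_ne_zero]
    exact X_pow_sub_C_ne_zero (hb i) 1
  have hinj := IsFractionRing.injective ℤ[X] (RatFunc ℤ)
  rw [qQuotient, Finset.prod_div_distrib, ← algebraMap_prod_one_sub_X_pow,
    ← algebraMap_prod_one_sub_X_pow, eq_div_iff ((map_ne_zero_iff _ hinj).2 hne), ← map_mul,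
    hinj.eq_iff]

theorem toset_indexedMultiset {n : ℕ} (b : Fin n → ℕ) (I : Finset (Fin n)) :
    toset (indexedMultiset b I) = b '' (I : Set (Fin n)) := by
  ext x
  simp [toset, indexedMultiset]

theorem card_multisetInterSet {n : ℕ} (a b : Fin n → ℕ) (I : Finset (Fin n)) :
    (multisetInterSet (indexedMultiset a Finset.univ)
      (generatedSemigroup (toset (indexedMultiset b I)))).card =
      semigroupCount a b Finset.univ I := by
  rw [toset_indexedMultiset, multisetInterSet, indexedMultiset, Multiset.filter_map,
    Multiset.card_map]
  rfl

theorem card_le_semigroupCount {n : ℕ} {a b : Fin n → ℕ} (hb_pos : ∀ i, 0 < b i)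
    (ha : Monotone a) (hb : Monotone b) {first penult last : Fin n}
    (hfirst : (first : ℕ) = 0) (hpenult : (penult : ℕ) = n - 2)
    (hlast : (last : ℕ) = n - 1)
    (hdvd : ∀ d, 0 < d → (Finset.univ.filter fun i => d ∣ b i).card ≤
      (Finset.univ.filter fun i => d ∣ a i).card)
    (hbound : 2 * b last * (b penult / 2) < a first + b first) (I : Finset (Fin n)) :
    I.card ≤ semigroupCount a b Finset.univ I := by
  classical
  rcases I.eq_empty_or_nonempty with rfl | hI
  · simp
  set g := I.gcd b with hg
  have hmin := I.min'_mem hI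
  have hg0 : 0 < g := Nat.pos_of_dvd_of_pos (Finset.gcd_dvd hmin) (hb_pos _)
  have h1 : I.card ≤ (Finset.univ.filter fun i => g ∣ b i).card :=
    Finset.card_le_card fun i hi => by simpa using Finset.gcd_dvd hi
  refine (h1.trans (hdvd g hg0)).trans (Finset.card_le_card fun j hj => ?_)
  have hgj : g ∣ a j := by simpa using hj
  simp only [Finset.mem_filter, Finset.mem_univ, true_and]
  rcases Nat.lt_or_ge 1 I.card with hcard | hcard
  · refine mem_closure_of_schur_bound hmin (hb_pos _) (M := b last)
      (fun i _ => hb (Fin.le_def.2 (by omega) : i ≤ last)) hgj ?_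
    -- Two indices in I keep the smallest off the last place, which is why b_{n-1} enters the bound.
    have hle : I.min' hI ≤ penult := by
      have h2 := Finset.min'_lt_max'_of_card I hcard
      have h3 := (I.max' hI).2
      rw [Fin.lt_def] at h2
      rw [Fin.le_def]
      omega
    have h4 := hb hle
    have h5 : b first ≤ b (I.min' hI) := hb (Fin.le_def.2 (by omega))
    have h6 : a first ≤ a j := ha (Fin.le_def.2 (by omega))
    -- For either parity, m - 1 ≤ 2⌊m/2⌋.
    have h7 : b (I.min' hI) / I.gcd b - 1 ≤ 2 * (b penult / 2) := by
      have := Nat.div_le_self (b (I.min' hI)) (I.gcd b)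
      omega
    calc _ ≤ 2 * (b penult / 2) * b last := Nat.mul_le_mul_right _ h7
      _ = 2 * b last * (b penult / 2) := by ring
      _ < _ := hbound
      _ ≤ _ := by omega
  · obtain ⟨i, rfl⟩ := Finset.card_eq_one.1 (le_antisymm hcard hI.card_pos)
    obtain ⟨k, hk⟩ : b i ∣ a j := by simpa [hg] using hgj
    rw [hk, mul_comm, ← smul_eq_mul]
    exact nsmul_mem (AddSubmonoid.subset_closure (Set.mem_image_of_mem b (by simp))) k

theorem mainTheorem2 (n : ℕ) (hn : 2 ≤ n) (a b : Fin n → ℕ)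
    (ha_pos : ∀ i, 0 < a i) (hb_pos : ∀ i, 0 < b i)
    (ha : Monotone a) (hb : Monotone b)
    (hpoly : ∃ P : ℤ[X], algebraMap ℤ[X] (RatFunc ℤ) P = qQuotient a b)
    (hbound : 2 * (b ⟨n - 1, by omega⟩ : ℤ) * ⌊(b ⟨n - 2, by omega⟩ : ℚ) / 2⌋
        - (b ⟨0, by omega⟩ : ℤ) < (a ⟨0, by omega⟩ : ℤ)) :
    (∀ I : Finset (Fin n),
      I.card ≤ (multisetInterSet (indexedMultiset a Finset.univ)
        (generatedSemigroup (toset (indexedMultiset b I)))).card) ∧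
    ∃ P : ℤ[X], algebraMap ℤ[X] (RatFunc ℤ) P = qQuotient a b ∧ ∀ k, 0 ≤ P.coeff k := by
  obtain ⟨P, hP⟩ := hpoly
  have hPmul := (algebraMap_eq_qQuotient_iff hb_pos).1 hP
  have hfloor : ⌊(b ⟨n - 2, by omega⟩ : ℚ) / 2⌋ = ((b ⟨n - 2, by omega⟩ / 2 : ℕ) : ℤ) := by
    exact_mod_cast Rat.floor_natCast_div_natCast (b ⟨n - 2, by omega⟩) 2
  rw [hfloor] at hbound
  have hgood := card_le_semigroupCount hb_pos ha hb
    (first := ⟨0, by omega⟩) (penult := ⟨n - 2, by omega⟩) (last := ⟨n - 1, by omega⟩) rfl rfl rfl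
    (fun d hd => card_dvd_le_of_prod_dvd ha_pos hb_pos ⟨P, by rw [← hPmul, mul_comm]⟩ hd)
    (by zify; push_cast at hbound; linarith)
  refine ⟨fun I => (hgood I).trans_eq (card_multisetInterSet a b I).symm, P, hP, fun k => ?_⟩
  obtain ⟨H, hH, hHmul⟩ := exists_nonneg_powerSeries ha_pos hb_pos hgood
  have hcoe : ∀ c : Fin n → ℕ, ((∏ i, (1 - X ^ c i) : ℤ[X]) : PowerSeries ℤ) =
      ∏ i, (1 - PowerSeries.X ^ c i) := fun c => by
    rw [← coeToPowerSeries.ringHom_apply, map_prod]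
    simp
  have hne : (∏ i, (1 - PowerSeries.X ^ b i) : PowerSeries ℤ) ≠ 0 := by
    refine Finset.prod_ne_zero_iff.2 fun i _ h => ?_
    have := congrArg (PowerSeries.coeff 0) h
    simp [(hb_pos i).ne'] at this
  have hPH : (P : PowerSeries ℤ) = H := by
    refine mul_right_cancel₀ hne ?_
    rw [hHmul, ← hcoe, ← hcoe, ← hPmul, coe_mul]
  rw [← coeff_coe, hPH]
  exact hH k

end Main
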